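/- For positive integers $L$ and $s$, let $C_{L,s}$ be the set of integer partitions whose smallest part is $s$, all of whose parts are $\le L+s$, and in which $L+s-1$ does not appear as a part. Let $D_{L,s}$ be the set of nonempty partitions with all parts in $\{s+1,\ldots,L+s\}$. If moreover $L\ge s+1$, let $C^{*}_{L,s}$ be the set of partitions whose smallest part is $s$, all of whose parts are $\le L+s$, and in which $L$ does not appear as a part. Write $|\pi|$ for the sum of the parts of a partition $\pi$. Put $$P_{L,s}=(s+1)(s+2)\cdots(s+L),$$ $$\gamma(L,s)=\bigl((s+1)+(s+2)+\cdots+(s+L)\bigr)\Bigl(P_{L,s}^{(P_{L,s}^2-1)L+2}+\bigl((P_{L,s}^2-1)L-2\bigr)P_{L,s}\Bigr),$$ $$\Gamma(s)=\gamma(3s+2,s).$$ Let $L\ge 3$ and $s\geq 1$ be integers. Then for every integer $N\ge\Gamma(s)$, $$|\{\pi\in C_{L,s}:|\pi|=N\}|\ \ge\ |\{\pi\in D_{L,s}:|\pi|=N\}|,$$ and, if in addition $L\ge s+1$, then for every integer $N\ge\Gamma(s)$, $$|\{\pi\in C^{*}_{L,s}:|\pi|=N\}|\ \ge\ |\{\pi\in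 D_{L,s}:|\pi|=N\}|.$$ -/

import Mathlib

namespace PartIneq

/-- `P_{L,s} = (s+1)(s+2)⋯(s+L)`. -/
def P (L s : ℕ) : ℕ := ∏ i ∈ Finset.Icc 1 L, (s + i)

/-- `γ(L,s) = ((s+1)+⋯+(s+L)) · (P^((P²-1)L+2) + ((P²-1)L-2)P)` with `P = P_{L,s}`.
For positive `L` and `s` one has `P ≥ 2`, so none of the subtractions truncates. -/
def gammaBound (L s : ℕ) : ℕ :=
  (∑ i ∈ Finset.Icc 1 L, (s + i)) *
    (P L s ^ ((P L s ^ 2 - 1) * L + 2) + ((P L s ^ 2 - 1) * L - 2) * P L s)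

/-- `Γ(s) = γ(3s+2, s)`. -/
def GammaBound (s : ℕ) : ℕ := gammaBound (3 * s + 2) s

/-- The partitions of `N` in `I_{L,s,k}`: the smallest part is `s` (it occurs, and every part is at
least `s`), all parts are at most `L + s`, and `k` is not a part. -/
def partsI (L s k N : ℕ) : Finset (Nat.Partition N) :=
  Finset.univ.filter fun p =>
    s ∈ p.parts ∧ (∀ i ∈ p.parts, s ≤ i) ∧ (∀ i ∈ p.parts, i ≤ L + s) ∧ k ∉ p.parts

/-- The partitions of `N` in `C_{L,s}`, where the part `L + s - 1` is forbidden. -/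
def partsC (L s N : ℕ) : Finset (Nat.Partition N) := partsI L s (L + s - 1) N

/-- The partitions of `N` in `C*_{L,s}` (considered for `L ≥ s + 1`), where the part `L` is
forbidden. -/
def partsCStar (L s N : ℕ) : Finset (Nat.Partition N) := partsI L s L N

/-- The partitions of `N` in `D_{L,s}`: nonempty, with all parts in `{s+1, …, L+s}`. -/
def partsD (L s N : ℕ) : Finset (Nat.Partition N) :=
  Finset.univ.filter fun p => p.parts ≠ 0 ∧ ∀ i ∈ p.parts, s + 1 ≤ i ∧ i ≤ L + s

end PartIneq

/-!
Choose a set `A` of at most two of the parts `s + 1`, `s + 2`, `s + 3`, avoiding the forbidden part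
`k`, and let `W` consist of the parts in `{s + 1, …, L + s}` outside `A ∪ {k}`. Splitting a
partition into its parts in `W` and the others, the count for `D` is at most
`∑ n, p(A ∪ {k}, n) p(W, N - n)`, and removing one compulsory part `s` shows that the count with
`s` required and `k` forbidden is at least `∑ n, p(A ∪ {s}, n - s) p(W, N - n)`.

The members of `A ∪ {k}` and `A ∪ {s}` are the same except that `s < k`, so for large `n` the second
set has more partitions, by an amount that tends to infinity. For `A` of two consecutive integers
this holds because they are coprime; for `k = s + 2` one takes `A = {s + 1}`, whose element is
coprime to both `s` and `k`. The bounded deficit at small `n` is absorbed by the surplus at large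
`n`: for `m` large the number `p(W, m)` is at most twice the sum of the `p(W, j)` over
`j ≤ m - B`. No constant here depends on `L`.
-/

namespace PartIneq

open Finset

/-- The partitions of `n` with all parts in `W`, encoded as multisets of positive integers so that
partitions of different integers have the same type. -/
def partitionsIn (W : Finset ℕ) (n : ℕ) : Finset (Multiset ℕ) :=
  (Nat.Partition.restricted n (· ∈ W)).image Nat.Partition.parts

lemma mem_partitionsIn {W : Finset ℕ} {n : ℕ} {M : Multiset ℕ} :
    M ∈ partitionsIn W n ↔ (∀ i ∈ M, 0 < i ∧ i ∈ W) ∧ M.sum = n := by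
  simp only [partitionsIn, Nat.Partition.restricted, mem_image, mem_filter, mem_univ, true_and]
  constructor
  · rintro ⟨p, hp, rfl⟩
    exact ⟨fun i hi => ⟨p.parts_pos hi, hp i hi⟩, p.parts_sum⟩
  · rintro ⟨hM, hsum⟩
    exact ⟨⟨M, fun hi => (hM _ hi).1, hsum⟩, fun i hi => (hM i hi).2, rfl⟩

lemma partitionsIn_mono {V W : Finset ℕ} (h : V ⊆ W) (n : ℕ) :
    partitionsIn V n ⊆ partitionsIn W n := fun _ hM =>
  mem_partitionsIn.2 ⟨fun i hi => ⟨((mem_partitionsIn.1 hM).1 i hi).1,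
    h ((mem_partitionsIn.1 hM).1 i hi).2⟩, (mem_partitionsIn.1 hM).2⟩

lemma add_mem_partitionsIn_union {V W : Finset ℕ} {m n : ℕ} {M M' : Multiset ℕ}
    (hM : M ∈ partitionsIn V m) (hM' : M' ∈ partitionsIn W n) :
    M + M' ∈ partitionsIn (V ∪ W) (m + n) := by
  rw [mem_partitionsIn] at *
  refine ⟨fun i hi => ?_, by rw [Multiset.sum_add, hM.2, hM'.2]⟩
  rw [mem_union]
  rcases Multiset.mem_add.1 hi with hi | hi
  · exact ⟨(hM.1 i hi).1, .inl (hM.1 i hi).2⟩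
  · exact ⟨(hM'.1 i hi).1, .inr (hM'.1 i hi).2⟩

lemma filter_mem_partitionsIn {V W : Finset ℕ} {n : ℕ} {M : Multiset ℕ}
    (hM : M ∈ partitionsIn W n) :
    M.filter (· ∈ V) ∈ partitionsIn V (M.filter (· ∈ V)).sum :=
  mem_partitionsIn.2 ⟨fun i hi => ⟨((mem_partitionsIn.1 hM).1 i (Multiset.mem_of_mem_filter hi)).1,
    Multiset.of_mem_filter hi⟩, rfl⟩

lemma filter_mem_add_filter_mem {V W : Finset ℕ} (h : Disjoint V W) {n : ℕ} {M : Multiset ℕ}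
    (hM : M ∈ partitionsIn (V ∪ W) n) : M.filter (· ∈ V) + M.filter (· ∈ W) = M := by
  have hcongr : M.filter (· ∈ W) = M.filter (· ∉ V) := Multiset.filter_congr fun i hi => by
    have hi := mem_union.1 ((mem_partitionsIn.1 hM).1 i hi).2
    exact ⟨fun hW hV => disjoint_left.1 h hV hW, hi.resolve_left⟩
  rw [hcongr, Multiset.filter_add_not]

lemma filter_mem_add_of_disjoint {V W : Finset ℕ} (h : Disjoint V W) {m n : ℕ}
    {M M' : Multiset ℕ} (hM : M ∈ partitionsIn V m) (hM' : M' ∈ partitionsIn W n) :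
    (M + M').filter (· ∈ V) = M := by
  rw [Multiset.filter_add,
    Multiset.filter_eq_self.2 fun i hi => ((mem_partitionsIn.1 hM).1 i hi).2,
    Multiset.filter_eq_nil.2 fun i hi hV =>
      disjoint_left.1 h hV ((mem_partitionsIn.1 hM').1 i hi).2, add_zero]

lemma card_partitionsIn_union {V W : Finset ℕ} (h : Disjoint V W) (n : ℕ) :
    #(partitionsIn (V ∪ W) n) =
      ∑ m ∈ range (n + 1), #(partitionsIn V m) * #(partitionsIn W (n - m)) := by
  simp only [← card_product]
  rw [← card_sigma]
  refine card_nbij' (fun M => ⟨(M.filter (· ∈ V)).sum, M.filter (· ∈ V), M.filter (· ∈ W)⟩)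
    (fun x => x.2.1 + x.2.2) (fun M hM => ?_) (fun x hx => ?_)
    (fun M hM => filter_mem_add_filter_mem h hM) (fun x hx => ?_)
  · have hsum : (M.filter (· ∈ V)).sum + (M.filter (· ∈ W)).sum = n := by
      rw [← Multiset.sum_add, filter_mem_add_filter_mem h hM, (mem_partitionsIn.1 hM).2]
    simp only [coe_sigma, Set.mem_sigma_iff, mem_coe, mem_range, mem_product]
    refine ⟨by omega, filter_mem_partitionsIn hM, ?_⟩
    rw [← hsum, Nat.add_sub_cancel_left]
    exact filter_mem_partitionsIn hM
  · simp only [coe_sigma, Set.mem_sigma_iff, mem_coe, mem_range, mem_product] at hx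
    have hadd := add_mem_partitionsIn_union hx.2.1 hx.2.2
    rwa [Nat.add_sub_cancel' (by omega)] at hadd
  · obtain ⟨m, M, M'⟩ := x
    simp only [coe_sigma, Set.mem_sigma_iff, mem_coe, mem_range, mem_product] at hx
    have hV := filter_mem_add_of_disjoint h hx.2.1 hx.2.2
    have hW := filter_mem_add_of_disjoint h.symm hx.2.2 hx.2.1
    rw [add_comm] at hW
    simp only [hV, hW, (mem_partitionsIn.1 hx.2.1).2]

lemma card_partitionsIn_singleton {a : ℕ} (ha : 0 < a) (n : ℕ) :
    #(partitionsIn {a} n) = if a ∣ n then 1 else 0 := by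
  split_ifs with h
  · obtain ⟨t, rfl⟩ := h
    refine card_eq_one.2 ⟨Multiset.replicate t a, ?_⟩
    ext M
    simp only [mem_partitionsIn, mem_singleton]
    constructor
    · rintro ⟨hM, hsum⟩
      obtain hM := Multiset.eq_replicate_card.2 fun i hi => (hM i hi).2
      rw [hM, Multiset.sum_replicate, smul_eq_mul, mul_comm] at hsum
      rw [hM, Nat.eq_of_mul_eq_mul_left ha hsum]
    · rintro rfl
      refine ⟨fun i hi => ?_, by simp [mul_comm]⟩
      rw [Multiset.eq_of_mem_replicate hi]
      exact ⟨ha, rfl⟩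
  · refine card_eq_zero.2 (eq_empty_of_forall_notMem fun M hM => h ?_)
    rw [mem_partitionsIn] at hM
    rw [← hM.2]
    exact Multiset.dvd_sum fun i hi => (mem_singleton.1 (hM.1 i hi).2).symm.dvd

lemma card_partitionsIn_insert {a : ℕ} {W : Finset ℕ} (ha : 0 < a) (haW : a ∉ W) (n : ℕ) :
    #(partitionsIn (insert a W) n) = ∑ x ∈ range (n / a + 1), #(partitionsIn W (n - a * x)) := by
  rw [insert_eq, card_partitionsIn_union (disjoint_singleton_left.2 haW)]
  simp only [card_partitionsIn_singleton ha, ite_mul, one_mul, zero_mul]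
  rw [← sum_filter]
  refine sum_nbij' (· / a) (a * ·) ?_ ?_ ?_ ?_ ?_
  · intro m hm
    rw [mem_filter, mem_range, Nat.lt_succ_iff] at hm
    exact mem_range.2 (Nat.lt_succ_iff.2 (Nat.div_le_div_right hm.1))
  · intro x hx
    rw [mem_range, Nat.lt_succ_iff, Nat.le_div_iff_mul_le ha, mul_comm] at hx
    exact mem_filter.2 ⟨mem_range.2 (Nat.lt_succ_iff.2 hx), dvd_mul_right a x⟩
  · exact fun m hm => Nat.mul_div_cancel' (mem_filter.1 hm).2
  · exact fun x _ => Nat.mul_div_cancel_left x ha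
  · exact fun m hm => by rw [Nat.mul_div_cancel' (mem_filter.1 hm).2]

lemma card_partitionsIn_le_pow (W : Finset ℕ) (n : ℕ) :
    #(partitionsIn W n) ≤ (n + 1) ^ #W := by
  have hpi : #(W.pi fun _ => range (n + 1)) = (n + 1) ^ #W := by simp
  rw [← hpi]
  refine card_le_card_of_injOn (fun M i _ => M.count i) (fun M hM => ?_) fun M hM M' hM' h => ?_
  · rw [mem_coe, mem_partitionsIn] at hM
    refine mem_coe.2 (mem_pi.2 fun i _ => mem_range.2 (Nat.lt_succ_iff.2 ?_))
    calc M.count i ≤ M.card := Multiset.count_le_card i M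
      _ ≤ M.sum := by
        simpa using Multiset.card_nsmul_le_sum (a := 1) fun i hi => (hM.1 i hi).1
      _ = n := hM.2
  · rw [mem_coe, mem_partitionsIn] at hM hM'
    ext i
    by_cases hi : i ∈ W
    · exact congrFun (congrFun h i) hi
    · rw [Multiset.count_eq_zero.2 fun h => hi (hM.1 i h).2,
        Multiset.count_eq_zero.2 fun h => hi (hM'.1 i h).2]

lemma exists_card_partitionsIn_pair_eq_count {a b : ℕ} (ha : 0 < a) (hb : 0 < b) (hab : a ≠ b)
    (hcop : a.Coprime b) (n : ℕ) :
    ∃ v, #(partitionsIn {a, b} n) = (n / a + 1).count (· ≡ v [MOD b]) := by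
  obtain ⟨v, -, hv⟩ := Nat.exists_mul_mod_eq_of_coprime n hcop hb.ne'
  refine ⟨v, ?_⟩
  rw [card_partitionsIn_insert ha (by simpa using hab), Nat.count_eq_card_filter_range,
    card_filter]
  refine sum_congr rfl fun x hx => ?_
  rw [mem_range, Nat.lt_succ_iff, Nat.le_div_iff_mul_le ha, mul_comm] at hx
  rw [card_partitionsIn_singleton hb]
  refine if_congr ?_ rfl rfl
  rw [← Nat.modEq_iff_dvd' hx]
  exact ⟨fun h => .cancel_left_of_coprime hcop.symm (h.trans hv.symm),
    fun h => (h.mul_left a).trans hv⟩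

lemma div_le_card_partitionsIn_pair {a b : ℕ} (ha : 0 < a) (hb : 0 < b) (hab : a ≠ b)
    (hcop : a.Coprime b) (n : ℕ) : n / (a * b) ≤ #(partitionsIn {a, b} n) := by
  obtain ⟨v, hv⟩ := exists_card_partitionsIn_pair_eq_count ha hb hab hcop n
  rw [hv, Nat.count_modEq_card _ hb, ← Nat.div_div_eq_div_mul]
  exact (Nat.div_le_div_right (Nat.le_succ _)).trans (Nat.le_add_right _ _)

lemma card_partitionsIn_pair_le {a b : ℕ} (ha : 0 < a) (hb : 0 < b) (hab : a ≠ b)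
    (hcop : a.Coprime b) (n : ℕ) : #(partitionsIn {a, b} n) ≤ n / (a * b) + 1 := by
  obtain ⟨v, hv⟩ := exists_card_partitionsIn_pair_eq_count ha hb hab hcop n
  rw [hv, Nat.count_modEq_card _ hb, ← Nat.div_div_eq_div_mul, Nat.succ_div]
  have hmod : b ∣ n / a + 1 → ¬ v % b < (n / a + 1) % b := fun h => by
    rw [Nat.dvd_iff_mod_eq_zero.1 h]
    exact Nat.not_lt_zero _
  split_ifs with hdvd hlt
  · exact absurd hlt (hmod hdvd)
  all_goals omega

lemma exists_lt_or_le_count_of_pow_three_lt_sum {M : Multiset ℕ} {B : ℕ} (h : B ^ 3 < M.sum) :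
    ∃ i ∈ M, B < i ∨ B ≤ M.count i := by
  by_contra! hM
  have hterm : ∀ i ∈ M.toFinset, M.count i * i ≤ (B - 1) * B := fun i hi =>
    have := hM i (Multiset.mem_toFinset.1 hi)
    Nat.mul_le_mul (by omega) this.1
  have hcard : #M.toFinset ≤ B + 1 := by
    rw [← card_range (B + 1)]
    exact card_le_card fun i hi =>
      mem_range.2 (Nat.lt_succ_iff.2 (hM i (Multiset.mem_toFinset.1 hi)).1)
  have hsum : M.sum ≤ B ^ 3 := by
    calc M.sum = ∑ i ∈ M.toFinset, M.count i * i := by simp [sum_multiset_count]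
      _ ≤ #M.toFinset * ((B - 1) * B) := sum_le_card_nsmul _ _ _ hterm
      _ ≤ (B + 1) * ((B - 1) * B) := Nat.mul_le_mul_right _ hcard
      _ = (B ^ 2 - 1) * B := by rw [← mul_assoc, ← Nat.sq_sub_sq, one_pow]
      _ ≤ B ^ 3 := by rw [pow_succ B 2]; exact Nat.mul_le_mul_right _ (Nat.sub_le _ _)
  omega

lemma exists_sub_mem_partitionsIn {W : Finset ℕ} {n : ℕ} {M R : Multiset ℕ}
    (hM : M ∈ partitionsIn W n) (hR : R ≤ M) :
    ∃ j, j + R.sum = n ∧ M - R ∈ partitionsIn W j := by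
  rw [mem_partitionsIn] at hM
  refine ⟨(M - R).sum, ?_, mem_partitionsIn.2 ⟨fun i hi => ?_, rfl⟩⟩
  · rw [← Multiset.sum_add, Multiset.sub_add_cancel hR, hM.2]
  · exact hM.1 i (Multiset.mem_of_le (Multiset.sub_le_self M R) hi)

/-- A partition of `m` becomes one of some `j ≤ m - B` by deleting either one part exceeding `B` or
`B` copies of a part; it is recovered from `j`, the result and the choice between the two. -/
lemma card_partitionsIn_le_two_mul_sum (W : Finset ℕ) {B m : ℕ} (hB : 0 < B) (hm : B ^ 3 < m) :
    #(partitionsIn W m) ≤ 2 * ∑ j ∈ range (m - B + 1), #(partitionsIn W j) := by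
  let extensions (j : ℕ) : Finset (Multiset ℕ) :=
    (partitionsIn W j).image (· + Multiset.replicate 1 (m - j)) ∪
      (partitionsIn W j).image (· + Multiset.replicate B ((m - j) / B))
  have hcover : partitionsIn W m ⊆ (range (m - B + 1)).biUnion extensions := by
    intro M hM
    obtain ⟨hpos, hsum⟩ := mem_partitionsIn.1 hM
    obtain ⟨i, hi, hBi⟩ := exists_lt_or_le_count_of_pow_three_lt_sum (hm.trans_eq hsum.symm)
    rw [mem_biUnion]
    rcases hBi with hBi | hBi
    · have hle : Multiset.replicate 1 i ≤ M := by simpa using hi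
      obtain ⟨j, hj, hsub⟩ := exists_sub_mem_partitionsIn hM hle
      rw [Multiset.sum_replicate, one_smul] at hj
      refine ⟨j, mem_range.2 (by omega), mem_union_left _ (mem_image.2 ⟨_, hsub, ?_⟩)⟩
      rw [← hj, Nat.add_sub_cancel_left, Multiset.sub_add_cancel hle]
    · have hle : Multiset.replicate B i ≤ M := Multiset.le_count_iff_replicate_le.1 hBi
      obtain ⟨j, hj, hsub⟩ := exists_sub_mem_partitionsIn hM hle
      rw [Multiset.sum_replicate, smul_eq_mul] at hj
      have hBBi : B ≤ B * i := Nat.le_mul_of_pos_right B (hpos i hi).1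
      refine ⟨j, mem_range.2 (by omega), mem_union_right _ (mem_image.2 ⟨_, hsub, ?_⟩)⟩
      rw [← hj, Nat.add_sub_cancel_left, Nat.mul_div_cancel_left i hB,
        Multiset.sub_add_cancel hle]
  calc #(partitionsIn W m) ≤ #((range (m - B + 1)).biUnion extensions) := card_le_card hcover
    _ ≤ ∑ j ∈ range (m - B + 1), #(extensions j) := card_biUnion_le
    _ ≤ ∑ j ∈ range (m - B + 1), 2 * #(partitionsIn W j) := sum_le_sum fun j _ => by
      rw [two_mul]
      exact (card_union_le _ _).trans (Nat.add_le_add card_image_le card_image_le)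
    _ = 2 * ∑ j ∈ range (m - B + 1), #(partitionsIn W j) := (mul_sum _ _ _).symm

lemma sum_range_card_partitionsIn_le (W : Finset ℕ) {B n₀ N : ℕ} (hB : 0 < B)
    (hN : B ^ 3 + n₀ ≤ N) :
    ∑ n ∈ range n₀, #(partitionsIn W (N - n)) ≤
      2 * n₀ * ∑ n ∈ Ico B (N + 1), #(partitionsIn W (N - n)) := by
  have hBpow : B ≤ B ^ 3 := Nat.le_self_pow (by norm_num) B
  have hterm : ∀ n ∈ range n₀, #(partitionsIn W (N - n)) ≤
      2 * ∑ n ∈ Ico B (N + 1), #(partitionsIn W (N - n)) := by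
    intro n hn
    rw [mem_range] at hn
    rw [sum_Ico_reflect (fun j => #(partitionsIn W j)) B le_rfl, Nat.sub_self,
      Nat.Ico_zero_eq_range]
    refine (card_partitionsIn_le_two_mul_sum W hB (by omega)).trans (Nat.mul_le_mul_left 2 ?_)
    exact sum_le_sum_of_subset (range_subset_range.2 (by omega))
  refine (sum_le_card_nsmul _ _ _ hterm).trans_eq ?_
  rw [card_range, smul_eq_mul, mul_left_comm, mul_assoc]

lemma sum_mul_card_partitionsIn_le (W : Finset ℕ) {c d : ℕ → ℕ} {n₀ n₁ K N : ℕ} (h₀₁ : n₀ ≤ n₁)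
    (hn₁ : 0 < n₁) (hlow : ∀ n < n₀, d n ≤ K) (hmid : ∀ n, n₀ ≤ n → d n ≤ c n)
    (hhigh : ∀ n, n₁ ≤ n → d n + 2 * n₀ * K ≤ c n) (hN : n₁ ^ 3 + n₀ ≤ N) :
    ∑ n ∈ range (N + 1), d n * #(partitionsIn W (N - n)) ≤
      ∑ n ∈ Ico n₀ (N + 1), c n * #(partitionsIn W (N - n)) := by
  have hpow : n₁ ≤ n₁ ^ 3 := Nat.le_self_pow (by norm_num) n₁
  have hdeficit : ∑ n ∈ range n₀, d n * #(partitionsIn W (N - n)) ≤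
      2 * n₀ * K * ∑ n ∈ Ico n₁ (N + 1), #(partitionsIn W (N - n)) := by
    calc _ ≤ ∑ n ∈ range n₀, K * #(partitionsIn W (N - n)) :=
          sum_le_sum fun n hn => Nat.mul_le_mul_right _ (hlow n (mem_range.1 hn))
      _ = K * ∑ n ∈ range n₀, #(partitionsIn W (N - n)) := (mul_sum _ _ _).symm
      _ ≤ K * (2 * n₀ * ∑ n ∈ Ico n₁ (N + 1), #(partitionsIn W (N - n))) :=
          Nat.mul_le_mul_left K (sum_range_card_partitionsIn_le W hn₁ hN)
      _ = _ := by ring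
  have hmiddle : ∑ n ∈ Ico n₀ n₁, d n * #(partitionsIn W (N - n)) ≤
      ∑ n ∈ Ico n₀ n₁, c n * #(partitionsIn W (N - n)) :=
    sum_le_sum fun n hn => Nat.mul_le_mul_right _ (hmid n (mem_Ico.1 hn).1)
  have hsurplus : ∑ n ∈ Ico n₁ (N + 1), d n * #(partitionsIn W (N - n)) +
      2 * n₀ * K * ∑ n ∈ Ico n₁ (N + 1), #(partitionsIn W (N - n)) ≤
      ∑ n ∈ Ico n₁ (N + 1), c n * #(partitionsIn W (N - n)) := by
    rw [mul_sum, ← sum_add_distrib]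
    refine sum_le_sum fun n hn => ?_
    rw [← add_mul]
    exact Nat.mul_le_mul_right _ (hhigh n (mem_Ico.1 hn).1)
  rw [← sum_range_add_sum_Ico _ (by omega : n₀ ≤ N + 1),
    ← sum_Ico_consecutive _ h₀₁ (by omega : n₁ ≤ N + 1),
    ← sum_Ico_consecutive _ h₀₁ (by omega : n₁ ≤ N + 1)]
  omega

lemma card_partitionsIn_pair_add_le {s k a T n : ℕ} (hs : 0 < s) (hsk : s < k) (ha : 0 < a)
    (hsa : s ≠ a) (hka : k ≠ a) (hscop : s.Coprime a) (hkcop : k.Coprime a)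
    (hn : (T + 2) * (s * k * a) ≤ n) :
    #(partitionsIn {k, a} n) + T ≤ #(partitionsIn {s, a} (n - s)) := by
  have hk : 0 < k := hs.trans hsk
  refine (Nat.add_le_add_right (card_partitionsIn_pair_le hk ha hka hkcop n) T).trans
    (le_trans ?_ (div_le_card_partitionsIn_pair hs ha hsa hscop (n - s)))
  have hfloor : n / (k * a) * (k * a) ≤ n := Nat.div_mul_le_self n (k * a)
  generalize n / (k * a) = u at hfloor
  have hska : s * k ≤ s * k * a := Nat.le_mul_of_pos_right _ ha
  have hbound : k * ((u + 1 + T) * (s * a) + s) ≤ k * n := by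
    calc k * ((u + 1 + T) * (s * a) + s)
        = s * (u * (k * a)) + ((T + 1) * (s * k * a) + s * k) := by ring
      _ ≤ s * n + (T + 2) * (s * k * a) := by nlinarith
      _ ≤ s * n + n := Nat.add_le_add_left hn _
      _ = (s + 1) * n := by ring
      _ ≤ k * n := Nat.mul_le_mul_right n hsk
  rw [Nat.le_div_iff_mul_le (Nat.mul_pos hs ha)]
  exact Nat.le_sub_of_add_le (Nat.le_of_mul_le_mul_left hbound hk)

section Coprime

variable {a b : ℕ}

lemma le_mul_card_partitionsIn_pair_add (ha : 0 < a) (hb : 0 < b) (hab : a ≠ b)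
    (hcop : a.Coprime b) (n : ℕ) : n ≤ a * b * #(partitionsIn {a, b} n) + a * b := by
  have hdiv := (Nat.lt_mul_div_succ n (Nat.mul_pos ha hb)).le
  rw [mul_add_one] at hdiv
  have := Nat.mul_le_mul_left (a * b) (div_le_card_partitionsIn_pair ha hb hab hcop n)
  omega

lemma mul_card_partitionsIn_pair_le (ha : 0 < a) (hb : 0 < b) (hab : a ≠ b)
    (hcop : a.Coprime b) (n : ℕ) : a * b * #(partitionsIn {a, b} n) ≤ n + a * b := by
  have hdiv := Nat.mul_div_le n (a * b)
  have := Nat.mul_le_mul_left (a * b) (card_partitionsIn_pair_le ha hb hab hcop n)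
  rw [mul_add_one] at this
  omega

lemma mul_card_partitionsIn_triple_le {k p : ℕ} (ha : 0 < a) (hb : 0 < b) (hab : a ≠ b)
    (hcop : a.Coprime b) (hk : k ∉ ({a, b} : Finset ℕ)) (hp : 0 < p) (hpk : p ≤ k) (n : ℕ) :
    a * b * #(partitionsIn {k, a, b} n) ≤ ∑ x ∈ range (n / p + 1), (n - p * x + a * b) := by
  rw [card_partitionsIn_insert (hp.trans_le hpk) hk, mul_sum]
  calc ∑ x ∈ range (n / k + 1), a * b * #(partitionsIn {a, b} (n - k * x))
      ≤ ∑ x ∈ range (n / k + 1), (n - p * x + a * b) := sum_le_sum fun x _ =>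
        (mul_card_partitionsIn_pair_le ha hb hab hcop _).trans
          (Nat.add_le_add_right (Nat.sub_le_sub_left (Nat.mul_le_mul_right x hpk) n) _)
    _ ≤ ∑ x ∈ range (n / p + 1), (n - p * x + a * b) := sum_le_sum_of_subset
        (range_subset_range.2 (Nat.succ_le_succ (Nat.div_le_div_left hpk hp)))

lemma sum_le_mul_card_partitionsIn_triple_add {s t n : ℕ} (ha : 0 < a) (hb : 0 < b)
    (hab : a ≠ b) (hcop : a.Coprime b) (hs : 0 < s) (hsab : s ∉ ({a, b} : Finset ℕ))
    (ht : t ≤ n / s + 1) :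
    ∑ x ∈ range t, (n - s * x) ≤ a * b * #(partitionsIn {s, a, b} n) + a * b * t := by
  calc ∑ x ∈ range t, (n - s * x)
      ≤ ∑ x ∈ range t, (a * b * #(partitionsIn {a, b} (n - s * x)) + a * b) :=
        sum_le_sum fun x _ => le_mul_card_partitionsIn_pair_add ha hb hab hcop _
    _ = a * b * ∑ x ∈ range t, #(partitionsIn {a, b} (n - s * x)) + a * b * t := by
        rw [sum_add_distrib, mul_sum, sum_const, card_range, smul_eq_mul, mul_comm t]
    _ ≤ a * b * #(partitionsIn {s, a, b} n) + a * b * t := by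
        rw [card_partitionsIn_insert hs hsab]
        gcongr

lemma mul_card_partitionsIn_triple_add_sum_le {s k n : ℕ} (ha : 0 < a) (hb : 0 < b)
    (hab : a ≠ b) (hcop : a.Coprime b) (hs : 0 < s) (hsk : s < k)
    (hsab : s ∉ ({a, b} : Finset ℕ)) (hkab : k ∉ ({a, b} : Finset ℕ)) (hsn : s ≤ n) :
    a * b * #(partitionsIn {k, a, b} n) + ∑ x ∈ range (n / (s + 1)), (x + 1) ≤
      a * b * #(partitionsIn {s, a, b} (n - s)) + 2 * (a * b) * (n / (s + 1)) + n + a * b := by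
  have hupper := mul_card_partitionsIn_triple_le ha hb hab hcop hkab s.succ_pos hsk n
  have hlower := sum_le_mul_card_partitionsIn_triple_add (t := n / (s + 1)) (n := n - s)
    ha hb hab hcop hs hsab (by
      rw [← Nat.add_div_right _ hs, Nat.sub_add_cancel hsn]
      exact Nat.div_le_div_left s.le_succ hs)
  have hterms : ∑ x ∈ range (n / (s + 1)), (n - (s + 1) * (x + 1)) +
      ∑ x ∈ range (n / (s + 1)), (x + 1) = ∑ x ∈ range (n / (s + 1)), (n - s - s * x) := by
    rw [← sum_add_distrib]
    refine sum_congr rfl fun x hx => ?_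
    have hxn : (s + 1) * (x + 1) ≤ n :=
      (Nat.mul_le_mul_left _ (mem_range.1 hx)).trans (Nat.mul_div_le n (s + 1))
    have hexpand : (s + 1) * (x + 1) = s + s * x + (x + 1) := by ring
    omega
  rw [sum_range_succ', sum_add_distrib, sum_const, card_range, smul_eq_mul, mul_zero,
    Nat.sub_zero] at hupper
  linarith

/-- After removing `x + 1` copies of `s + 1` from `n`, respectively `x` copies of `s` from `n - s`,
the remainders differ by `x + 1`. The total gain `J (J + 1) / 2` with `J = n / (s + 1)` beats the
error terms, which are linear in `J`. -/
lemma card_partitionsIn_triple_add_le {s k T n : ℕ} (ha : 0 < a) (hb : 0 < b) (hab : a ≠ b)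
    (hcop : a.Coprime b) (hs : 0 < s) (hsk : s < k) (hsab : s ∉ ({a, b} : Finset ℕ))
    (hkab : k ∉ ({a, b} : Finset ℕ)) (hn : (s + 1) * (4 * (a * b) + 2 * s + 4 + 2 * T) ≤ n) :
    #(partitionsIn {k, a, b} n) + T ≤ #(partitionsIn {s, a, b} (n - s)) := by
  have hq : 0 < a * b := Nat.mul_pos ha hb
  have hsn : s ≤ n := le_trans (by nlinarith) hn
  have hgain := mul_card_partitionsIn_triple_add_sum_le ha hb hab hcop hs hsk hsab hkab hsn
  have hgauss := sum_range_id_mul_two (n / (s + 1) + 1)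
  rw [sum_range_succ', add_zero, Nat.add_sub_cancel] at hgauss
  have hn_lt := Nat.lt_mul_div_succ n s.succ_pos
  have hJ := (Nat.le_div_iff_mul_le s.succ_pos).2 ((mul_comm _ _).trans_le hn)
  generalize n / (s + 1) = J at *
  generalize ∑ x ∈ range J, (x + 1) = S at *
  generalize a * b = q at *
  have herror : 2 * (2 * q * J + n + q + q * T) ≤ 2 * S := by
    nlinarith [Nat.mul_le_mul_right J hJ, Nat.mul_le_mul_right T hJ]
  refine Nat.le_of_mul_le_mul_left (?_ : q * _ ≤ q * _) hq
  linarith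

end Coprime

lemma card_partsD_le_card_partitionsIn (L s N : ℕ) :
    #(partsD L s N) ≤ #(partitionsIn (Icc (s + 1) (L + s)) N) := by
  refine card_le_card_of_injOn Nat.Partition.parts (fun p hp => ?_)
    fun _ _ _ _ h => Nat.Partition.ext h
  simp only [partsD, coe_filter, mem_univ, true_and, Set.mem_ofPred_eq] at hp
  exact mem_partitionsIn.2 ⟨fun i hi => ⟨p.parts_pos hi, mem_Icc.2 (hp.2 i hi)⟩, p.parts_sum⟩

lemma card_partitionsIn_le_card_partsI {L s k N : ℕ} (hs : 0 < s) (hks : k ≠ s) (hsN : s ≤ N) :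
    #(partitionsIn ((Icc s (L + s)).erase k) (N - s)) ≤ #(partsI L s k N) := by
  refine (card_le_card (t := (partsI L s k N).image fun p => p.parts.erase s) fun M hM => ?_).trans
    card_image_le
  simp only [mem_partitionsIn, mem_erase, mem_Icc] at hM
  let p : Nat.Partition N := ⟨s ::ₘ M, fun hi => by
    rcases Multiset.mem_cons.1 hi with rfl | hi
    · exact hs
    · exact (hM.1 _ hi).1, by rw [Multiset.sum_cons, hM.2, Nat.add_sub_cancel' hsN]⟩
  refine mem_image.2 ⟨p, ?_, Multiset.erase_cons_head s M⟩
  simp only [partsI, mem_filter, mem_univ, true_and, p, Multiset.mem_cons, forall_eq_or_imp,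
    true_or, le_refl, not_or]
  exact ⟨fun i hi => (hM.1 i hi).2.2.1, ⟨Nat.le_add_left s L, fun i hi => (hM.1 i hi).2.2.2⟩,
    hks, fun hk => (hM.1 k hk).2.1 rfl⟩

lemma card_partsD_le_sum {L s N : ℕ} (k : ℕ) (A : Finset ℕ) :
    #(partsD L s N) ≤ ∑ n ∈ range (N + 1), #(partitionsIn (insert k A) n) *
      #(partitionsIn (Icc (s + 1) (L + s) \ insert k A) (N - n)) := by
  rw [← card_partitionsIn_union disjoint_sdiff]
  refine (card_partsD_le_card_partitionsIn L s N).trans (card_le_card (partitionsIn_mono ?_ N))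
  rw [union_sdiff_self_eq_union]
  exact subset_union_right

lemma sum_le_card_partsI {L s k N : ℕ} {A : Finset ℕ} (hs : 0 < s) (hks : k ≠ s) (hsN : s ≤ N)
    (hA : A ⊆ Icc (s + 1) (L + s)) (hkA : k ∉ A) :
    ∑ n ∈ Ico s (N + 1), #(partitionsIn (insert s A) (n - s)) *
      #(partitionsIn (Icc (s + 1) (L + s) \ insert k A) (N - n)) ≤ #(partsI L s k N) := by
  have hdisj : Disjoint (insert s A) (Icc (s + 1) (L + s) \ insert k A) := by
    refine disjoint_left.2 fun i hi hi' => ?_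
    simp only [mem_insert, mem_sdiff, mem_Icc, not_or] at hi hi'
    rcases hi with rfl | hi
    · omega
    · exact hi'.2.2 hi
  have hsub : insert s A ∪ Icc (s + 1) (L + s) \ insert k A ⊆ (Icc s (L + s)).erase k := by
    refine fun i hi => mem_erase.2 ?_
    simp only [mem_union, mem_insert, mem_sdiff, mem_Icc, not_or] at hi ⊢
    rcases hi with (rfl | hi) | hi
    · exact ⟨hks.symm, by omega⟩
    · have := mem_Icc.1 (hA hi)
      exact ⟨ne_of_mem_of_not_mem hi hkA, by omega⟩
    · exact ⟨hi.2.1, by omega⟩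
  calc _ = #(partitionsIn (insert s A ∪ Icc (s + 1) (L + s) \ insert k A) (N - s)) := by
        rw [card_partitionsIn_union hdisj, sum_Ico_eq_sum_range, Nat.sub_add_comm hsN]
        simp only [Nat.add_sub_cancel_left, Nat.sub_sub]
    _ ≤ #(partitionsIn ((Icc s (L + s)).erase k) (N - s)) :=
        card_le_card (partitionsIn_mono hsub _)
    _ ≤ #(partsI L s k N) := card_partitionsIn_le_card_partsI hs hks hsN

lemma threshold_le_pow {e : ℕ} (he : 3 ≤ e) : (e * (2 * e * e ^ 3 + 1)) ^ 3 + e ≤ e ^ 19 := by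
  have hn₁ : e * (2 * e * e ^ 3 + 1) ≤ e ^ 6 := by
    calc e * (2 * e * e ^ 3 + 1) = 2 * e ^ 5 + e ^ 1 := by ring
      _ ≤ 2 * e ^ 5 + e ^ 5 := by gcongr <;> omega
      _ = 3 * e ^ 5 := by ring
      _ ≤ e * e ^ 5 := Nat.mul_le_mul_right _ he
      _ = e ^ 6 := by ring
  calc (e * (2 * e * e ^ 3 + 1)) ^ 3 + e ≤ (e ^ 6) ^ 3 + e ^ 18 := by
        gcongr
        exact Nat.le_self_pow (by norm_num) e
    _ = 2 * e ^ 18 := by ring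
    _ ≤ e * e ^ 18 := Nat.mul_le_mul_right _ (by omega)
    _ = e ^ 19 := by ring

lemma card_partsD_le_card_partsI_of_surplus {L s k e N : ℕ} {A : Finset ℕ} (hs : 0 < s)
    (hks : k ≠ s) (hA : A ⊆ Icc (s + 1) (L + s)) (hcardA : #A ≤ 2) (hkA : k ∉ A) (he : 3 ≤ e)
    (hse : s ≤ e)
    (hsurplus : ∀ T n, e * (T + 1) ≤ n →
      #(partitionsIn (insert k A) n) + T ≤ #(partitionsIn (insert s A) (n - s)))
    (hN : e ^ 19 ≤ N) : #(partsD L s N) ≤ #(partsI L s k N) := by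
  have hsN : s ≤ N := (hse.trans (Nat.le_self_pow (by norm_num) e)).trans hN
  have hlow : ∀ n < e, #(partitionsIn (insert k A) n) ≤ e ^ 3 := fun n hn =>
    calc #(partitionsIn (insert k A) n) ≤ (n + 1) ^ #(insert k A) := card_partitionsIn_le_pow _ n
      _ ≤ e ^ #(insert k A) := Nat.pow_le_pow_left hn _
      _ ≤ e ^ 3 := Nat.pow_le_pow_right (by omega) ((card_insert_le k A).trans (by omega))
  refine (card_partsD_le_sum k A).trans (le_trans ?_ (sum_le_card_partsI hs hks hsN hA hkA))
  refine (sum_mul_card_partitionsIn_le _ (c := fun n => #(partitionsIn (insert s A) (n - s)))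
    (Nat.le_mul_of_pos_right e (Nat.succ_pos _)) (by positivity) hlow
    (fun n hn => hsurplus 0 n (by simpa using hn)) (hsurplus _)
    ((threshold_le_pow he).trans hN)).trans ?_
  exact sum_le_sum_of_subset (Ico_subset_Ico_left hse)

lemma card_partitionsIn_consecutive_add_le {s k a T n : ℕ} (hs : 0 < s) (hsk : s < k) (hsa : s < a)
    (has : a ≤ s + 2) (hka : k ∉ ({a, a + 1} : Finset ℕ)) (hn : (s + 3) ^ 4 * (T + 1) ≤ n) :
    #(partitionsIn {k, a, a + 1} n) + T ≤ #(partitionsIn {s, a, a + 1} (n - s)) := by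
  have hsa' : s ∉ ({a, a + 1} : Finset ℕ) := by rw [mem_insert, mem_singleton]; omega
  refine card_partitionsIn_triple_add_le (hs.trans hsa) a.succ_pos (by omega) (by simp) hs hsk hsa'
    hka (le_trans ?_ hn)
  calc (s + 1) * (4 * (a * (a + 1)) + 2 * s + 4 + 2 * T)
      ≤ (s + 1) * (4 * ((s + 2) * (s + 2 + 1)) + 2 * s + 4 + 2 * T) := by gcongr
    _ ≤ (s + 3) * (4 * (s + 3) ^ 2 * (T + 1)) := by
      refine Nat.mul_le_mul (by omega) ?_
      nlinarith [Nat.zero_le (s * T), Nat.zero_le (s ^ 2 * T)]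
    _ = 4 * (s + 3) ^ 3 * (T + 1) := by ring
    _ ≤ (s + 3) * (s + 3) ^ 3 * (T + 1) := by gcongr; omega
    _ = (s + 3) ^ 4 * (T + 1) := by ring

lemma card_partitionsIn_add_two_add_le {s T n : ℕ} (hs : 0 < s)
    (hn : (s + 3) ^ 4 * (T + 1) ≤ n) :
    #(partitionsIn {s + 2, s + 1} n) + T ≤ #(partitionsIn {s, s + 1} (n - s)) := by
  have hcop : (s + 2).Coprime (s + 1) :=
    (Nat.coprime_self_add_right.2 (Nat.coprime_one_right _)).symm
  refine card_partitionsIn_pair_add_le hs (by omega) s.succ_pos (by omega) (by omega) (by simp)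
    hcop (le_trans ?_ hn)
  calc (T + 2) * (s * (s + 2) * (s + 1))
      ≤ (s + 3) * (T + 1) * ((s + 3) * (s + 3) * (s + 3)) := by
        gcongr
        · nlinarith
        all_goals omega
    _ = (s + 3) ^ 4 * (T + 1) := by ring

lemma exists_card_partitionsIn_insert_add_le {L s k : ℕ} (hL : 3 ≤ L) (hs : 0 < s) (hsk : s < k) :
    ∃ A ⊆ Icc (s + 1) (L + s), #A ≤ 2 ∧ k ∉ A ∧ ∀ T n, (s + 3) ^ 4 * (T + 1) ≤ n →
      #(partitionsIn (insert k A) n) + T ≤ #(partitionsIn (insert s A) (n - s)) := by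
  have hsub (a : ℕ) (hsa : s < a) (has : a ≤ s + 2) : {a, a + 1} ⊆ Icc (s + 1) (L + s) := by
    intro i hi
    rw [mem_insert, mem_singleton] at hi
    exact mem_Icc.2 (by omega)
  rcases (by omega : k = s + 1 ∨ k = s + 2 ∨ s + 3 ≤ k) with rfl | rfl | hk
  · have hnotMem : s + 1 ∉ ({s + 2, s + 2 + 1} : Finset ℕ) := by simp
    exact ⟨{s + 2, s + 2 + 1}, hsub _ (by omega) le_rfl, card_le_two, hnotMem, fun T n hn =>
      card_partitionsIn_consecutive_add_le hs hsk (by omega) le_rfl hnotMem hn⟩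
  · exact ⟨{s + 1}, singleton_subset_iff.2 (mem_Icc.2 (by omega)), by simp, by simp, fun T n hn =>
      card_partitionsIn_add_two_add_le hs hn⟩
  · have hnotMem : k ∉ ({s + 1, s + 1 + 1} : Finset ℕ) := by
      rw [mem_insert, mem_singleton]; omega
    exact ⟨{s + 1, s + 1 + 1}, hsub _ (by omega) (by omega), card_le_two, hnotMem, fun T n hn =>
      card_partitionsIn_consecutive_add_le hs hsk (by omega) (by omega) hnotMem hn⟩

lemma pow_le_GammaBound {s : ℕ} (hs : 0 < s) : (s + 3) ^ 76 ≤ GammaBound s := by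
  have hP : s + 4 ≤ P (3 * s + 2) s :=
    single_le_prod' (f := fun i => s + i) (fun i hi => by have := mem_Icc.1 hi; omega)
      (mem_Icc.2 (by omega : 1 ≤ 4 ∧ 4 ≤ 3 * s + 2))
  have hsum : 0 < ∑ i ∈ Icc 1 (3 * s + 2), (s + i) :=
    sum_pos (fun i _ => by omega) ⟨1, mem_Icc.2 (by omega)⟩
  rw [GammaBound, gammaBound]
  generalize P (3 * s + 2) s = p at *
  have hexponent : 76 ≤ (p ^ 2 - 1) * (3 * s + 2) + 2 := by
    have hp : 5 ^ 2 ≤ p ^ 2 := Nat.pow_le_pow_left (by omega) 2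
    have := Nat.mul_le_mul (by omega : 24 ≤ p ^ 2 - 1) (by omega : 5 ≤ 3 * s + 2)
    omega
  calc (s + 3) ^ 76 ≤ p ^ 76 := Nat.pow_le_pow_left (by omega) 76
    _ ≤ p ^ ((p ^ 2 - 1) * (3 * s + 2) + 2) := Nat.pow_le_pow_right (by omega) hexponent
    _ ≤ p ^ ((p ^ 2 - 1) * (3 * s + 2) + 2) + ((p ^ 2 - 1) * (3 * s + 2) - 2) * p :=
      Nat.le_add_right _ _
    _ ≤ _ := Nat.le_mul_of_pos_left _ hsum

end PartIneq

theorem mainTheorem3_general (L s k : ℕ) (hL : 3 ≤ L) (hs : 1 ≤ s) (hsk : s < k) (N : ℕ)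
    (hN : (s + 3) ^ 76 ≤ N) :
    (PartIneq.partsD L s N).card ≤ (PartIneq.partsI L s k N).card := by
  obtain ⟨A, hA, hcardA, hkA, hsurplus⟩ := PartIneq.exists_card_partitionsIn_insert_add_le hL hs hsk
  have hbase : s + 3 ≤ (s + 3) ^ 4 := Nat.le_self_pow (by norm_num) _
  refine PartIneq.card_partsD_le_card_partsI_of_surplus hs hsk.ne' hA hcardA hkA (by omega)
    (by omega) hsurplus ?_
  exact (pow_mul (s + 3) 4 19).symm.trans_le hN

theorem mainTheorem3 (L s : ℕ) (hL : 3 ≤ L) (hs : 1 ≤ s) (N : ℕ)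
    (hN : PartIneq.GammaBound s ≤ N) :
    (PartIneq.partsD L s N).card ≤ (PartIneq.partsC L s N).card ∧
      (s + 1 ≤ L → (PartIneq.partsD L s N).card ≤ (PartIneq.partsCStar L s N).card) := by
  have hN' := (PartIneq.pow_le_GammaBound hs).trans hN
  exact ⟨mainTheorem3_general L s (L + s - 1) hL hs (by omega) N hN',
    fun hsL => mainTheorem3_general L s L hL hs hsL N hN'⟩
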